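/- Let $\mathbb{D}$ be the open unit disk in $\mathbb{C}$, let $H(\mathbb{D})$ be the space of analytic functions on $\mathbb{D}$, and let $dA$ be the area measure on $\mathbb{D}$ normalized so that $A(\mathbb{D})=1$. For $w\in\mathbb{D}$ put $k_w(z)=\dfrac{1}{(1-\overline{w}z)^2}$ and $\|k_w\|_{A^1}=\int_{\mathbb{D}}|k_w(z)|\,dA(z)$. Let $X$ be the normed space of all $f\in H(\mathbb{D})$ with $$\|f\|_X=\sup_{z\in\mathbb{D}}|f(z)|\,\|k_z\|_{A^1}^{-1}<\infty ,$$ and let the Bloch space $\mathcal{B}$ be the set of all $f\in H(\mathbb{D})$ with $\sup_{z\in\mathbb{D}}(1-|z|^2)|f'(z)|<\infty$. Theorem. The Bloch space is not dense in $X$; that is, $\mathcal{B}\cap X$ is not a dense subset of $X$ for the norm $\|\cdot\|_X$. (It is known that $\mathcal{B}\subset X$.) -/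

import Mathlib

open MeasureTheory Metric
open scoped ComplexConjugate Complex.UnitDisc

noncomputable section

namespace BlochX

/-- Extension by zero of a function on the open unit disc to the plane. It is only ever
evaluated or differentiated at points of the (open) disc. -/
def extendZero (f : 𝔻 → ℂ) : ℂ → ℂ := Function.extend ((↑) : 𝔻 → ℂ) f 0

theorem extendZero_coe (f : 𝔻 → ℂ) (z : 𝔻) : extendZero f (z : ℂ) = f z :=
  Complex.UnitDisc.coe_injective.extend_apply f 0 z

theorem extendZero_add (f g : 𝔻 → ℂ) : extendZero (f + g) = extendZero f + extendZero g := by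
  have h := Function.extend_add ((↑) : 𝔻 → ℂ) f g (0 : ℂ → ℂ) 0
  rw [add_zero] at h
  exact h

theorem extendZero_smul (c : ℂ) (f : 𝔻 → ℂ) : extendZero (c • f) = c • extendZero f := by
  have h := Function.extend_smul c ((↑) : 𝔻 → ℂ) f (0 : ℂ → ℂ)
  rw [smul_zero] at h
  exact h

theorem extendZero_zero : extendZero 0 = 0 := Function.extend_zero _

/-- The analytic functions on the open unit disc, as a subspace of all functions on the disc. -/
def analyticSubmodule : Submodule ℂ (𝔻 → ℂ) where
  carrier := {f | DifferentiableOn ℂ (extendZero f) (ball (0 : ℂ) 1)}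
  add_mem' {f g} hf hg := by
    simp only [Set.mem_ofPred_eq] at hf hg ⊢
    rw [extendZero_add]
    exact hf.add hg
  zero_mem' := by
    simp only [Set.mem_ofPred_eq]
    rw [extendZero_zero]
    exact differentiableOn_const 0
  smul_mem' c f hf := by
    simp only [Set.mem_ofPred_eq] at hf ⊢
    rw [extendZero_smul]
    exact hf.const_smul c

/-- `H(𝔻)`, the vector space of analytic functions on the open unit disc. It is a separate type
so that it does not inherit the topology of pointwise convergence. -/
def HolDisc : Type := analyticSubmodule

instance : AddCommGroup HolDisc := inferInstanceAs (AddCommGroup analyticSubmodule)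

instance : Module ℂ HolDisc := inferInstanceAs (Module ℂ analyticSubmodule)

namespace HolDisc

instance : CoeFun HolDisc (fun _ => 𝔻 → ℂ) := ⟨Subtype.val⟩

theorem ext {f g : HolDisc} (h : ∀ z, f z = g z) : f = g := Subtype.ext (funext h)

theorem differentiableOn (f : HolDisc) : DifferentiableOn ℂ (extendZero f) (ball (0 : ℂ) 1) := f.2

theorem add_apply (f g : HolDisc) (z : 𝔻) : (f + g) z = f z + g z := rfl

theorem smul_apply (c : ℂ) (f : HolDisc) (z : 𝔻) : (c • f) z = c * f z := rfl

theorem zero_apply (z : 𝔻) : (0 : HolDisc) z = 0 := rfl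

/-- The complex derivative `f'(z)` at a point of the disc. -/
def derivAt (f : HolDisc) (z : 𝔻) : ℂ := deriv (extendZero f) (z : ℂ)

theorem differentiableAt (f : HolDisc) (z : 𝔻) : DifferentiableAt ℂ (extendZero f) (z : ℂ) :=
  f.differentiableOn.differentiableAt
    (isOpen_ball.mem_nhds (mem_ball_zero_iff.2 z.norm_lt_one))

theorem derivAt_add (f g : HolDisc) (z : 𝔻) : (f + g).derivAt z = f.derivAt z + g.derivAt z := by
  have h : extendZero (f + g : HolDisc) = extendZero f + extendZero g := extendZero_add f g
  rw [derivAt, h]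
  exact deriv_add (f.differentiableAt z) (g.differentiableAt z)

theorem derivAt_smul (c : ℂ) (f : HolDisc) (z : 𝔻) : (c • f).derivAt z = c * f.derivAt z := by
  have h : extendZero (c • f : HolDisc) = c • extendZero f := extendZero_smul c f
  rw [derivAt, h]
  exact deriv_const_smul c (f.differentiableAt z)

theorem derivAt_zero (z : 𝔻) : (0 : HolDisc).derivAt z = 0 := by
  have h : extendZero (0 : HolDisc) = 0 := extendZero_zero
  rw [derivAt, h]
  exact deriv_const _ _

end HolDisc

/-- The Bloch space: analytic `f` with `sup_z (1 - |z|²) |f'(z)| < ∞`. -/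
def Bloch : Submodule ℂ HolDisc where
  carrier := {f | BddAbove (Set.range fun z : 𝔻 => (1 - ‖(z : ℂ)‖ ^ 2) * ‖f.derivAt z‖)}
  add_mem' {f g} hf hg := by
    obtain ⟨A, hA⟩ := hf
    obtain ⟨B, hB⟩ := hg
    refine ⟨A + B, ?_⟩
    rintro _ ⟨z, rfl⟩
    have h1 := hA ⟨z, rfl⟩
    have h2 := hB ⟨z, rfl⟩
    have h3 : 0 ≤ 1 - ‖(z : ℂ)‖ ^ 2 := by linarith [z.sq_norm_lt_one]
    have h4 := mul_le_mul_of_nonneg_left (norm_add_le (f.derivAt z) (g.derivAt z)) h3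
    simp only [HolDisc.derivAt_add] at *
    linarith
  zero_mem' := by
    refine ⟨0, ?_⟩
    rintro _ ⟨z, rfl⟩
    simp [HolDisc.derivAt_zero]
  smul_mem' c f hf := by
    obtain ⟨A, hA⟩ := hf
    refine ⟨‖c‖ * A, ?_⟩
    rintro _ ⟨z, rfl⟩
    have h1 := mul_le_mul_of_nonneg_left (hA ⟨z, rfl⟩) (norm_nonneg c)
    simp only [HolDisc.derivAt_smul, norm_mul] at *
    linarith

/-- The normalized area measure `dA` of the open unit disc. -/
def areaMeasure : Measure ℂ :=
  ENNReal.ofReal Real.pi⁻¹ • (volume : Measure ℂ).restrict (ball (0 : ℂ) 1)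

/-- The Bergman norm `‖g‖_{A¹} = ∫_𝔻 |g| dA`. -/
def normA1 (g : ℂ → ℂ) : ℝ := ∫ z, ‖g z‖ ∂areaMeasure

/-- The reproducing kernel `k_w(z) = 1 / (1 - w̄ z)²` of the Bergman space `A²`. -/
def kernel (w : 𝔻) (z : ℂ) : ℂ := 1 / (1 - conj (w : ℂ) * z) ^ 2

theorem one_sub_ne_zero (w : 𝔻) {z : ℂ} (hz : z ∈ closedBall (0 : ℂ) 1) :
    1 - conj (w : ℂ) * z ≠ 0 := by
  intro h
  have h1 : ‖conj (w : ℂ) * z‖ = 1 := by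
    rw [← sub_eq_zero.1 h, norm_one]
  rw [norm_mul, Complex.norm_conj] at h1
  have h2 := w.norm_lt_one
  have h3 : ‖z‖ ≤ 1 := mem_closedBall_zero_iff.1 hz
  have h4 := norm_nonneg (w : ℂ)
  nlinarith [norm_nonneg z]

theorem integrable_kernel (w : 𝔻) : Integrable (fun z => ‖kernel w z‖) areaMeasure := by
  refine Integrable.smul_measure ?_ ENNReal.ofReal_ne_top
  have h : ContinuousOn (fun z => ‖kernel w z‖) (closedBall (0 : ℂ) 1) := by
    refine ContinuousOn.norm (ContinuousOn.div continuousOn_const (by fun_prop) ?_)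
    intro z hz
    exact pow_ne_zero 2 (one_sub_ne_zero w hz)
  exact (h.integrableOn_compact (isCompact_closedBall 0 1)).mono_set ball_subset_closedBall

theorem normA1_kernel_pos (w : 𝔻) : 0 < normA1 (kernel w) := by
  rw [normA1, integral_pos_iff_support_of_nonneg (fun z => norm_nonneg _) (integrable_kernel w)]
  have hsub : ball (0 : ℂ) 1 ⊆ Function.support fun z => ‖kernel w z‖ := by
    intro z hz
    rw [Function.mem_support, norm_ne_zero_iff, kernel]
    exact div_ne_zero one_ne_zero
      (pow_ne_zero 2 (one_sub_ne_zero w (ball_subset_closedBall hz)))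
  refine lt_of_lt_of_le ?_ (measure_mono hsub)
  rw [areaMeasure, Measure.smul_apply, Measure.restrict_apply_self, smul_eq_mul]
  refine ENNReal.mul_pos ?_ ?_
  · exact (ENNReal.ofReal_pos.2 (inv_pos.2 Real.pi_pos)).ne'
  · exact (measure_ball_pos volume (0 : ℂ) one_pos).ne'

/-- The space `X`: analytic `f` with `sup_z |f(z)| ‖k_z‖_{A¹}⁻¹ < ∞`. -/
def X : Submodule ℂ HolDisc where
  carrier := {f | BddAbove (Set.range fun z : 𝔻 => ‖f z‖ * (normA1 (kernel z))⁻¹)}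
  add_mem' {f g} hf hg := by
    obtain ⟨A, hA⟩ := hf
    obtain ⟨B, hB⟩ := hg
    refine ⟨A + B, ?_⟩
    rintro _ ⟨z, rfl⟩
    have h1 := hA ⟨z, rfl⟩
    have h2 := hB ⟨z, rfl⟩
    have h4 := mul_le_mul_of_nonneg_right (norm_add_le (f z) (g z))
      (inv_pos.2 (normA1_kernel_pos z)).le
    simp only [HolDisc.add_apply] at *
    linarith
  zero_mem' := by
    refine ⟨0, ?_⟩
    rintro _ ⟨z, rfl⟩
    simp [HolDisc.zero_apply]
  smul_mem' c f hf := by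
    obtain ⟨A, hA⟩ := hf
    refine ⟨‖c‖ * A, ?_⟩
    rintro _ ⟨z, rfl⟩
    have h1 := mul_le_mul_of_nonneg_left (hA ⟨z, rfl⟩) (norm_nonneg c)
    simp only [HolDisc.smul_apply, norm_mul] at *
    linarith

/-- The norm `‖f‖_X = sup_z |f(z)| ‖k_z‖_{A¹}⁻¹`. -/
instance : Norm X := ⟨fun f => ⨆ z : 𝔻, ‖f.1 z‖ * (normA1 (kernel z))⁻¹⟩

theorem X.norm_def (f : X) : ‖f‖ = ⨆ z : 𝔻, ‖f.1 z‖ * (normA1 (kernel z))⁻¹ := rfl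

theorem X.le_norm (f : X) (z : 𝔻) : ‖f.1 z‖ * (normA1 (kernel z))⁻¹ ≤ ‖f‖ := le_ciSup f.2 z

theorem X.core : NormedSpace.Core ℂ X where
  norm_nonneg f := Real.iSup_nonneg fun z =>
    mul_nonneg (norm_nonneg _) (inv_pos.2 (normA1_kernel_pos z)).le
  norm_smul c f := by
    rw [X.norm_def, X.norm_def, Real.mul_iSup_of_nonneg (norm_nonneg c)]
    congr 1
    funext z
    rw [← mul_assoc, ← norm_mul]
    rfl
  norm_triangle f g := by
    refine ciSup_le fun z => ?_
    have h4 := mul_le_mul_of_nonneg_right (norm_add_le (f.1 z) (g.1 z))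
      (inv_pos.2 (normA1_kernel_pos z)).le
    rw [add_mul] at h4
    exact h4.trans (add_le_add (X.le_norm f z) (X.le_norm g z))
  norm_eq_zero_iff f := by
    constructor
    · intro h
      refine Subtype.ext (HolDisc.ext fun z => ?_)
      have h1 := X.le_norm f z
      rw [h] at h1
      have h2 := inv_pos.2 (normA1_kernel_pos z)
      have h3 : ‖f.1 z‖ ≤ 0 := by
        by_contra hc
        exact absurd h1 (not_le.2 (mul_pos (not_le.1 hc) h2))
      exact norm_le_zero_iff.1 h3
    · rintro rfl
      have h : ∀ z : 𝔻, ‖(0 : X).1 z‖ * (normA1 (kernel z))⁻¹ = 0 := fun z => by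
        have h0 : (0 : X).1 z = 0 := rfl
        rw [h0, norm_zero, zero_mul]
      rw [X.norm_def]
      simp only [h, Real.iSup_const_zero]

/-- `X` with the topology of the norm `‖·‖_X`. -/
instance : NormedAddCommGroup X := NormedAddCommGroup.ofCore X.core

instance : NormedSpace ℂ X := NormedSpace.ofCore X.core

end BlochX

end

/-! The norm of `X` allows faster growth than a Bloch function can follow on a sparse set of
frequencies. Polar coordinates give `|w|² ‖k_w‖ = -log (1 - |w|²)`, so `X` consists of the functions
of at most logarithmic growth. The coefficients of a Bloch function are bounded: Cauchy's formula
for `f'` on a circle of radius about `1 - 1/N` bounds the `N`-th one by a multiple of the Bloch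
seminorm.

The function `∑ 2ᵏ z ^ Nₖ` with `log Nₖ ≍ 2ᵏ` lies in `X` (`norm_lacunary_le`), yet its coefficients
are unbounded. At radius `1 - 1/(2Nₖ)` the kernel norm is only `O(2ᵏ)`
(`normA1_kernel_le_of_norm_eq`), so a small perturbation in `X` changes the `Nₖ`-th coefficient by
at most half of `2ᵏ`. A whole ball around this function therefore misses the Bloch space. -/

namespace BlochX

/-! ### The Bergman norm of the kernel -/

open Set Real in
/-- Integration over the open unit disc in polar coordinates. -/
theorem setIntegral_ball_eq_polar {g : ℂ → ℝ} (hg : ContinuousOn g (closedBall (0 : ℂ) 1)) :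
    ∫ z in ball (0 : ℂ) 1, g z =
      ∫ r in Ioo (0 : ℝ) 1, ∫ θ in (0 : ℝ)..2 * π, r * g (circleMap 0 r θ) := by
  have hsymm : ∀ p : ℝ × ℝ, Complex.polarCoord.symm p = circleMap 0 p.1 p.2 := by
    intro p
    rw [Complex.polarCoord_symm_apply, circleMap_zero, Complex.exp_mul_I,
      Complex.ofReal_cos, Complex.ofReal_sin]
  have hcont : Continuous fun p : ℝ × ℝ => circleMap 0 p.1 p.2 := by
    unfold circleMap; fun_prop
  have hint : IntegrableOn (fun p : ℝ × ℝ => p.1 * g (circleMap 0 p.1 p.2))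
      (Ioo (0 : ℝ) 1 ×ˢ Ioo (-π) π) (volume.prod volume) := by
    have h : ContinuousOn (fun p : ℝ × ℝ => p.1 * g (circleMap 0 p.1 p.2))
        (Icc (0 : ℝ) 1 ×ˢ Icc (-π) π) := by
      refine continuousOn_fst.mul (hg.comp hcont.continuousOn ?_)
      rintro ⟨r, θ⟩ ⟨hr, -⟩
      simpa [abs_of_nonneg hr.1] using hr.2
    exact (h.integrableOn_compact (isCompact_Icc.prod isCompact_Icc)).mono_set
      (prod_mono Ioo_subset_Icc_self Ioo_subset_Icc_self)
  rw [← integral_indicator measurableSet_ball, ← Complex.integral_comp_polarCoord_symm]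
  have hind : ∀ p ∈ polarCoord.target,
      p.1 • (ball (0 : ℂ) 1).indicator g (Complex.polarCoord.symm p) =
        (Ioo (0 : ℝ) 1 ×ˢ Ioo (-π) π).indicator
          (fun p : ℝ × ℝ => p.1 * g (circleMap 0 p.1 p.2)) p := by
    rintro ⟨r, θ⟩ ⟨hr, hθ⟩
    have hr' : 0 < r := hr
    rw [hsymm]
    by_cases h : r < 1
    · rw [indicator_of_mem (by simpa [abs_of_pos hr'] using h),
        indicator_of_mem (show (r, θ) ∈ Ioo (0 : ℝ) 1 ×ˢ Ioo (-π) π from ⟨⟨hr', h⟩, hθ⟩), smul_eq_mul]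
    · rw [indicator_of_notMem (by simpa [abs_of_pos hr'] using h),
        indicator_of_notMem (fun h' : (r, θ) ∈ Ioo (0 : ℝ) 1 ×ˢ Ioo (-π) π => h h'.1.2), smul_zero]
  have hsub : Ioo (0 : ℝ) 1 ×ˢ Ioo (-π) π ⊆ polarCoord.target := by
    rw [polarCoord_target]
    exact prod_mono (fun x hx => hx.1) subset_rfl
  rw [setIntegral_congr_fun polarCoord.open_target.measurableSet hind,
    setIntegral_indicator (measurableSet_Ioo.prod measurableSet_Ioo),
    inter_eq_right.2 hsub, Measure.volume_eq_prod, setIntegral_prod _ hint]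
  refine setIntegral_congr_fun measurableSet_Ioo fun r _ => ?_
  -- Polar coordinates use angles in `(-π, π)`, circle integrals use `[0, 2π]`; periodicity joins
  -- them.
  have hper : Function.Periodic (fun θ : ℝ => r * g (circleMap 0 r θ)) (2 * π) := fun θ => by
    simp only [periodic_circleMap 0 r θ]
  have h := hper.intervalIntegral_add_eq (-π) 0
  rw [show -π + 2 * π = π by ring, zero_add] at h
  simp only
  rw [← h, intervalIntegral.integral_of_le (by linarith [pi_pos]), integral_Ioc_eq_integral_Ioo]

open Real in
/-- The mean of `|1 - w̄ z|⁻²` over a circle is the value of the Cauchy integral of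
`(1 - w̄ z)⁻¹` at the reflected point `r² w`. -/
theorem integral_norm_kernel_circleMap (w : 𝔻) {r : ℝ} (hr : r ∈ Set.Ioo (0 : ℝ) 1) :
    ∫ θ in (0 : ℝ)..2 * π, ‖kernel w (circleMap 0 r θ)‖ = 2 * π / (1 - ‖(w : ℂ)‖ ^ 2 * r ^ 2) := by
  obtain ⟨hr0, hr1⟩ := hr
  have hd : DifferentiableOn ℂ (fun z => (1 - conj (w : ℂ) * z)⁻¹) (closedBall 0 r) := by
    refine DifferentiableOn.inv (by fun_prop) fun z hz =>
      one_sub_ne_zero w (closedBall_subset_closedBall hr1.le hz)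
  have hw : (w : ℂ) * r ^ 2 ∈ ball (0 : ℂ) r := by
    rw [mem_ball_zero_iff, norm_mul, norm_pow, Complex.norm_real, norm_of_nonneg hr0.le]
    nlinarith [w.norm_lt_one, norm_nonneg (w : ℂ), mul_pos hr0 hr0]
  have hC := hd.circleIntegral_sub_inv_smul hw
  have hpt : ∀ θ : ℝ, deriv (circleMap 0 r) θ •
      ((circleMap 0 r θ - (w : ℂ) * r ^ 2)⁻¹ • (1 - conj (w : ℂ) * circleMap 0 r θ)⁻¹) =
      Complex.I * ((‖kernel w (circleMap 0 r θ)‖ : ℝ) : ℂ) := by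
    intro θ
    set z := circleMap 0 r θ with hz
    have hzn : ‖z‖ = r := by rw [hz, norm_circleMap_zero, abs_of_pos hr0]
    have hz0 : z ≠ 0 := by rw [← norm_pos_iff, hzn]; exact hr0
    have hne : 1 - conj (w : ℂ) * z ≠ 0 :=
      one_sub_ne_zero w (mem_closedBall_zero_iff.2 (hzn.le.trans hr1.le))
    have hzz : z * conj z = (r : ℂ) ^ 2 := by
      rw [Complex.mul_conj, Complex.normSq_eq_norm_sq, hzn]; push_cast; rfl
    have hk : ((‖kernel w z‖ : ℝ) : ℂ) =
        ((1 - conj (w : ℂ) * z) * (1 - (w : ℂ) * conj z))⁻¹ := by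
      have h1 : (1 - (w : ℂ) * conj z) = conj (1 - conj (w : ℂ) * z) := by simp
      rw [h1, Complex.mul_conj, Complex.normSq_eq_norm_sq, kernel, norm_div, norm_one, norm_pow,
        one_div]
      push_cast; rfl
    have hne2 : 1 - (w : ℂ) * conj z ≠ 0 := by
      have h1 : (1 - (w : ℂ) * conj z) = conj (1 - conj (w : ℂ) * z) := by simp
      rw [h1]; exact (map_ne_zero _).2 hne
    -- On the circle `r² = z z̄`, so the Cauchy denominator at `r² w` supplies the conjugate factor
    -- that turns `(1 - w̄ z)⁻¹` into `|1 - w̄ z|⁻²`.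
    have hs : z - (w : ℂ) * r ^ 2 = z * (1 - (w : ℂ) * conj z) := by
      rw [← hzz]; ring
    rw [hk, deriv_circleMap, ← hz, hs, smul_eq_mul, smul_eq_mul]
    field_simp
  rw [circleIntegral] at hC
  simp only [hpt] at hC
  rw [intervalIntegral.integral_const_mul, intervalIntegral.integral_ofReal, smul_eq_mul] at hC
  have hww : conj (w : ℂ) * ((w : ℂ) * r ^ 2) = ((‖(w : ℂ)‖ ^ 2 * r ^ 2 : ℝ) : ℂ) := by
    rw [← mul_assoc, mul_comm (conj (w : ℂ)), Complex.mul_conj, Complex.normSq_eq_norm_sq]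
    push_cast; rfl
  rw [hww, mul_comm (2 * (π : ℂ)) Complex.I, mul_assoc] at hC
  have h2 := mul_left_cancel₀ Complex.I_ne_zero hC
  rw [div_eq_mul_inv]
  exact_mod_cast h2

-- The circle means reduce the area integral to `∫ 2r / (1 - |w|² r²) dr` over `(0, 1)`. The factor
-- `|w|²` makes the integrand an exact derivative and keeps `w = 0` in the statement.
open Real in
theorem norm_sq_mul_normA1_kernel (w : 𝔻) :
    ‖(w : ℂ)‖ ^ 2 * normA1 (kernel w) = -log (1 - ‖(w : ℂ)‖ ^ 2) := by
  have hcont : ContinuousOn (fun z => ‖kernel w z‖) (closedBall (0 : ℂ) 1) := by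
    refine ContinuousOn.norm (ContinuousOn.div continuousOn_const (by fun_prop) ?_)
    exact fun z hz => pow_ne_zero 2 (one_sub_ne_zero w hz)
  have ht := w.sq_norm_lt_one
  set t := ‖(w : ℂ)‖ ^ 2 with ht_def
  have ht0 : 0 ≤ t := sq_nonneg _
  have hpos : ∀ r ∈ Set.uIcc (0 : ℝ) 1, 0 < 1 - t * r ^ 2 := by
    intro r hr
    rw [Set.uIcc_of_le zero_le_one] at hr
    have h1 : r ^ 2 ≤ 1 := pow_le_one₀ hr.1 hr.2
    nlinarith [sq_nonneg r]
  have hA : normA1 (kernel w) = π⁻¹ * ∫ z in ball (0 : ℂ) 1, ‖kernel w z‖ := by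
    rw [normA1, areaMeasure, integral_smul_measure,
      ENNReal.toReal_ofReal (inv_pos.2 pi_pos).le, smul_eq_mul]
  have hinner : ∫ z in ball (0 : ℂ) 1, ‖kernel w z‖ =
      ∫ r in (0 : ℝ)..1, r * (2 * π / (1 - t * r ^ 2)) := by
    rw [setIntegral_ball_eq_polar hcont, intervalIntegral.integral_of_le zero_le_one,
      integral_Ioc_eq_integral_Ioo]
    refine setIntegral_congr_fun measurableSet_Ioo fun r hr => ?_
    simp only [intervalIntegral.integral_const_mul, integral_norm_kernel_circleMap w hr, ht_def]
  have hderiv : ∀ r ∈ Set.uIcc (0 : ℝ) 1, HasDerivAt (fun r => -log (1 - t * r ^ 2))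
      (t * π⁻¹ * (r * (2 * π / (1 - t * r ^ 2)))) r := by
    intro r hr
    have h1 : HasDerivAt (fun r : ℝ => 1 - t * r ^ 2) (-(t * (2 * r))) r := by
      simpa using ((hasDerivAt_pow 2 r).const_mul t).const_sub 1
    have h2 := (h1.log (hpos r hr).ne').neg
    convert! h2 using 1
    have := pi_pos.ne'
    field_simp
  have hftc := intervalIntegral.integral_eq_sub_of_hasDerivAt hderiv
    (ContinuousOn.intervalIntegrable (by
      refine continuousOn_const.mul (continuousOn_id.mul (continuousOn_const.div (by fun_prop) ?_))
      exact fun r hr => (hpos r hr).ne'))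
  rw [intervalIntegral.integral_const_mul] at hftc
  rw [hA, hinner, ← mul_assoc, hftc]
  simp

/-- These are partial sums of the nonnegative series of `-log (1 - t) / t` at `t = |w|²`. At `w = 0`
the factor `t` cannot be cancelled, but there the kernel is `1`. -/
theorem sum_range_pow_div_le_normA1_kernel (w : 𝔻) (M : ℕ) :
    ∑ n ∈ Finset.range M, (‖(w : ℂ)‖ ^ 2) ^ n / (n + 1) ≤ normA1 (kernel w) := by
  rcases eq_or_ne (w : ℂ) 0 with hw | hw
  · have h1 : normA1 (kernel w) = 1 := by
      simp [normA1, kernel, hw, areaMeasure, Measure.real, Real.pi_pos.le, Real.pi_ne_zero]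
    have h2 : ∀ n : ℕ, (‖(w : ℂ)‖ ^ 2) ^ n / ((n : ℝ) + 1) = if n = 0 then 1 else 0 := by
      intro n
      rcases eq_or_ne n 0 with rfl | hn <;> simp [*]
    simp only [h1, h2, Finset.sum_ite_eq']
    split_ifs <;> norm_num
  · have ht : 0 < ‖(w : ℂ)‖ ^ 2 := by positivity
    have hsum := Real.hasSum_pow_div_log_of_abs_lt_one
      (x := ‖(w : ℂ)‖ ^ 2) (by rw [abs_of_pos ht]; exact w.sq_norm_lt_one)
    have h := sum_le_hasSum (Finset.range M) (fun n _ => by positivity) hsum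
    rw [← norm_sq_mul_normA1_kernel] at h
    refine le_of_mul_le_mul_left (le_trans (le_of_eq ?_) h) ht
    rw [Finset.mul_sum]
    refine Finset.sum_congr rfl fun n _ => ?_
    rw [pow_succ' (‖(w : ℂ)‖ ^ 2) n, mul_div_assoc]

/-! ### The lacunary series and its membership in `X` -/

/-- The exponents of the lacunary series `∑ 2ᵏ z ^ Nₖ`; they satisfy `log Nₖ ≍ 2ᵏ`. -/
def lacunaryExponent (k : ℕ) : ℕ := 2 ^ (2 ^ (k + 1) + 2)

theorem lacunaryExponent_injective : Function.Injective lacunaryExponent := by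
  intro a b h
  have h1 := Nat.pow_right_injective le_rfl h
  have h2 := Nat.pow_right_injective le_rfl (Nat.add_right_cancel h1)
  omega

theorem lacunaryExponent_pos (k : ℕ) : 0 < lacunaryExponent k := by
  unfold lacunaryExponent; positivity

/-- Cauchy condensation: for `2ᴶ ≤ n < 2ᴶ⁺¹` each of the `2ᴶ` terms on the right is at least `r ^ 2
^ (J + 2) / 2ᴶ⁺¹`, so the block contributes at least half of the `J`-th term on the left. -/
theorem sum_dyadic_pow_le {r : ℝ} (h0 : 0 ≤ r) (h1 : r ≤ 1) (J : ℕ) :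
    ∑ j ∈ Finset.range J, r ^ 2 ^ (j + 2) ≤
      2 * ∑ n ∈ Finset.range (2 ^ J), (r ^ 2) ^ n / ((n : ℝ) + 1) := by
  induction J with
  | zero => simp
  | succ J ih =>
    rw [Finset.sum_range_succ, pow_succ 2 J, mul_two, Finset.sum_range_add, mul_add]
    refine add_le_add ih ?_
    have hterm : ∀ x ∈ Finset.range (2 ^ J), r ^ 2 ^ (J + 2) / (2 * 2 ^ J) ≤
        (r ^ 2) ^ (2 ^ J + x) / (((2 ^ J + x : ℕ) : ℝ) + 1) := by
      intro x hx
      have hx := Finset.mem_range.1 hx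
      have hx' : (x : ℝ) + 1 ≤ 2 ^ J := by exact_mod_cast hx
      rw [← pow_mul]
      refine div_le_div₀ (by positivity) (pow_le_pow_of_le_one h0 h1 ?_) (by positivity) ?_
      · rw [pow_add]; omega
      · push_cast; linarith
    have h := Finset.card_nsmul_le_sum _ _ _ hterm
    rw [Finset.card_range, nsmul_eq_mul] at h
    refine le_trans (le_of_eq ?_) (mul_le_mul_of_nonneg_left h zero_le_two)
    push_cast
    field_simp

/-- Condensation once more: the coefficient `2ᴷ` counts the indices `2ᴷ ≤ j < 2ᴷ⁺¹`, all of whose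
exponents are below `lacunaryExponent K`. -/
theorem sum_two_pow_mul_pow_lacunaryExponent_le {r : ℝ} (h0 : 0 ≤ r) (h1 : r ≤ 1) (K : ℕ) :
    ∑ k ∈ Finset.range K, 2 ^ k * r ^ lacunaryExponent k ≤
      ∑ j ∈ Finset.range (2 ^ K), r ^ 2 ^ (j + 2) := by
  induction K with
  | zero => simp [h0]
  | succ K ih =>
    rw [Finset.sum_range_succ, pow_succ 2 K, mul_two, Finset.sum_range_add]
    refine add_le_add ih ?_
    have hterm : ∀ x ∈ Finset.range (2 ^ K), r ^ lacunaryExponent K ≤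
        r ^ 2 ^ (2 ^ K + x + 2) := by
      intro x hx
      have hx := Finset.mem_range.1 hx
      refine pow_le_pow_of_le_one h0 h1 (Nat.pow_le_pow_right two_pos ?_)
      rw [pow_succ]; omega
    have h := Finset.card_nsmul_le_sum _ _ _ hterm
    rw [Finset.card_range, nsmul_eq_mul] at h
    exact_mod_cast h

theorem sum_two_pow_mul_norm_pow_le (z : 𝔻) (K : ℕ) :
    ∑ k ∈ Finset.range K, 2 ^ k * ‖(z : ℂ)‖ ^ lacunaryExponent k ≤ 2 * normA1 (kernel z) :=
  (sum_two_pow_mul_pow_lacunaryExponent_le (norm_nonneg _) z.norm_lt_one.le K).trans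
    ((sum_dyadic_pow_le (norm_nonneg _) z.norm_lt_one.le _).trans
      (mul_le_mul_of_nonneg_left (sum_range_pow_div_le_normA1_kernel z _) zero_le_two))

theorem summable_two_pow_mul_norm_pow (z : 𝔻) :
    Summable fun k => 2 ^ k * ‖(z : ℂ)‖ ^ lacunaryExponent k :=
  summable_of_sum_range_le (fun k => by positivity) (sum_two_pow_mul_norm_pow_le z)

theorem summable_two_pow_mul_pow {r : ℝ} (h0 : 0 ≤ r) (h1 : r < 1) :
    Summable fun k => 2 ^ k * r ^ lacunaryExponent k := by
  have hr : ‖(r : ℂ)‖ = r := by rw [Complex.norm_real, Real.norm_of_nonneg h0]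
  have h := summable_two_pow_mul_norm_pow (Complex.UnitDisc.mk (r : ℂ) (by rwa [hr]))
  simpa only [Complex.UnitDisc.coe_mk, hr] using h

/-- The lacunary series `∑ 2ᵏ z ^ Nₖ`. -/
noncomputable def lacunary (z : ℂ) : ℂ := ∑' k, 2 ^ k * z ^ lacunaryExponent k

theorem differentiableOn_lacunary : DifferentiableOn ℂ lacunary (ball (0 : ℂ) 1) := by
  intro z hz
  obtain ⟨ρ, hzρ, hρ⟩ := exists_between (mem_ball_zero_iff.1 hz)
  have hd : DifferentiableOn ℂ lacunary (ball (0 : ℂ) ρ) := by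
    refine Complex.differentiableOn_tsum_of_summable_norm
      (summable_two_pow_mul_pow ((norm_nonneg z).trans hzρ.le) hρ) (fun k => by fun_prop)
      isOpen_ball fun k w hw => ?_
    rw [norm_mul, norm_pow, norm_pow, Complex.norm_two]
    have := (mem_ball_zero_iff.1 hw).le
    gcongr
  exact (hd.differentiableAt
    (isOpen_ball.mem_nhds (mem_ball_zero_iff.2 hzρ))).differentiableWithinAt

theorem norm_lacunary_le (z : 𝔻) : ‖lacunary z‖ ≤ 2 * normA1 (kernel z) := by
  refine (norm_tsum_le_tsum_norm ?_).trans ?_ <;>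
    simp only [norm_mul, norm_pow, Complex.norm_two]
  · exact summable_two_pow_mul_norm_pow z
  · exact Real.tsum_le_of_sum_range_le (fun k => by positivity) (sum_two_pow_mul_norm_pow_le z)

theorem extendZero_restrict_eqOn (g : ℂ → ℂ) :
    Set.EqOn (extendZero fun z : 𝔻 => g z) g (ball (0 : ℂ) 1) := fun z hz =>
  extendZero_coe (fun z : 𝔻 => g z) (Complex.UnitDisc.mk z (mem_ball_zero_iff.1 hz))

/-- The lacunary series `∑ 2ᵏ z ^ Nₖ` as an element of `X`. -/
noncomputable def lacunaryX : X :=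
  ⟨⟨fun z => lacunary z, differentiableOn_lacunary.congr (extendZero_restrict_eqOn lacunary)⟩, by
    refine ⟨2, ?_⟩
    rintro _ ⟨z, rfl⟩
    exact (mul_inv_le_iff₀ (normA1_kernel_pos z)).2 (norm_lacunary_le z)⟩

/-! ### Coefficients as circle integrals -/

/-- Uniform convergence on the circle permits termwise integration, and since the exponents are
distinct only the `k`-th term has a residue. -/
theorem circleIntegral_lacunary_div_pow {r : ℝ} (h0 : 0 < r) (h1 : r < 1) (k : ℕ) :
    ∮ z in C(0, r), lacunary z / z ^ (lacunaryExponent k + 1) =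
      2 ^ k * (2 * Real.pi * Complex.I) := by
  set N := lacunaryExponent k with hN
  have hunif : TendstoUniformlyOn
      (fun (M : ℕ) (z : ℂ) => ∑ j ∈ Finset.range M, 2 ^ j * z ^ lacunaryExponent j / z ^ (N + 1))
      (fun z => ∑' j, 2 ^ j * z ^ lacunaryExponent j / z ^ (N + 1)) Filter.atTop
      (sphere (0 : ℂ) r) := by
    refine tendstoUniformlyOn_tsum_nat
      ((summable_two_pow_mul_pow h0.le h1).div_const (r ^ (N + 1))) fun j z hz => ?_
    rw [norm_div, norm_mul, norm_pow, norm_pow, norm_pow, Complex.norm_two,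
      mem_sphere_zero_iff_norm.1 hz]
  have hne : ∀ z ∈ sphere (0 : ℂ) r, z ≠ 0 := fun z hz =>
    ne_of_mem_sphere hz h0.ne'
  have hcont : ∀ j, ContinuousOn (fun z : ℂ => 2 ^ j * z ^ lacunaryExponent j / z ^ (N + 1))
      (sphere (0 : ℂ) r) := fun j =>
    ContinuousOn.div (by fun_prop) (by fun_prop) fun z hz => pow_ne_zero _ (hne z hz)
  have hlim := hunif.tendsto_circleIntegral_of_continuousOn h0.le
    (Filter.Eventually.of_forall fun M => continuousOn_finsetSum _ fun j _ => hcont j)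
  have hterm : ∀ j, ∮ z in C(0, r), 2 ^ j * z ^ lacunaryExponent j / z ^ (N + 1) =
      if j = k then 2 ^ k * (2 * Real.pi * Complex.I) else 0 := by
    intro j
    have h : ∮ z in C(0, r), 2 ^ j * z ^ lacunaryExponent j / z ^ (N + 1) =
        ∮ z in C(0, r), 2 ^ j * (z - 0) ^ ((lacunaryExponent j : ℤ) - (N + 1 : ℕ)) := by
      refine circleIntegral.integral_congr h0.le fun z hz => ?_
      simp only [sub_zero]
      rw [zpow_sub₀ (hne z hz), zpow_natCast, zpow_natCast, mul_div_assoc]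
    rw [h, circleIntegral.integral_const_mul]
    split_ifs with hjk
    · have he : (lacunaryExponent j : ℤ) - (N + 1 : ℕ) = -1 := by rw [hjk, hN]; push_cast; ring
      simp only [he, zpow_neg_one]
      rw [circleIntegral.integral_sub_center_inv _ h0.ne', hjk]
    · rw [circleIntegral.integral_sub_zpow_of_ne, mul_zero]
      intro he
      refine hjk (lacunaryExponent_injective ?_)
      push_cast at he
      omega
  have hconst : Filter.Tendsto (fun M : ℕ => ∮ z in C(0, r),
      ∑ j ∈ Finset.range M, 2 ^ j * z ^ lacunaryExponent j / z ^ (N + 1)) Filter.atTop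
      (nhds (2 ^ k * (2 * Real.pi * Complex.I))) := by
    refine tendsto_const_nhds.congr' ?_
    filter_upwards [Filter.eventually_gt_atTop k] with M hM
    rw [circleIntegral.integral_fun_sum fun j _ => (hcont j).circleIntegrable h0.le]
    simp [hterm, hM]
  rw [← tendsto_nhds_unique hlim hconst]
  refine circleIntegral.integral_congr h0.le fun z _ => ?_
  simp only [lacunary, tsum_div_const]

/-- Integration by parts on a circle. -/
theorem circleIntegral_deriv_div_pow {f : ℂ → ℂ} (hf : DifferentiableOn ℂ f (ball (0 : ℂ) 1))
    {r : ℝ} (h0 : 0 < r) (h1 : r < 1) (N : ℕ) :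
    ∮ z in C(0, r), deriv f z / z ^ N = N * ∮ z in C(0, r), f z / z ^ (N + 1) := by
  have hne : ∀ z ∈ sphere (0 : ℂ) r, z ≠ 0 := fun z hz => ne_of_mem_sphere hz h0.ne'
  have hmem : ∀ z ∈ sphere (0 : ℂ) r, z ∈ ball (0 : ℂ) 1 := fun z hz => by
    rw [mem_ball_zero_iff, mem_sphere_zero_iff_norm.1 hz]; exact h1
  have hint : CircleIntegrable (fun z => deriv f z / z ^ N) 0 r :=
    ContinuousOn.circleIntegrable h0.le
      (((hf.deriv isOpen_ball).continuousOn.mono hmem).div (by fun_prop)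
        fun z hz => pow_ne_zero _ (hne z hz))
  have hint' : CircleIntegrable (fun z => (N : ℂ) * (f z / z ^ (N + 1))) 0 r :=
    ContinuousOn.circleIntegrable h0.le
      (continuousOn_const.mul ((hf.continuousOn.mono hmem).div (by fun_prop)
        fun z hz => pow_ne_zero _ (hne z hz)))
  rw [← sub_eq_zero, ← circleIntegral.integral_const_mul, ← circleIntegral.integral_sub hint hint']
  refine circleIntegral.integral_eq_zero_of_hasDerivWithinAt (f := fun z => f z / z ^ N) h0.le
    fun z hz => HasDerivAt.hasDerivWithinAt ?_
  have hz0 := hne z hz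
  have hfz := (hf.differentiableAt (isOpen_ball.mem_nhds (hmem z hz))).hasDerivAt
  convert! hfz.div (hasDerivAt_pow N z) (pow_ne_zero _ hz0) using 1
  -- The derivative of `z ^ N` carries the truncated exponent `N - 1`, so `N = 0` is separate.
  rcases N with _ | N
  · simp
  · rw [Nat.add_sub_cancel]
    field_simp
    ring

/-! ### Separation from the Bloch space -/

/-- Here `1 - r² ≥ 1/(2Nₖ)`, and `log (2Nₖ) = (2·2ᵏ + 3) log 2 ≤ 5·2ᵏ`; dividing by `r² ≥ 1/4` gives
the constant `20`. -/
theorem normA1_kernel_le_of_norm_eq {k : ℕ} {w : 𝔻}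
    (hw : ‖(w : ℂ)‖ = 1 - 1 / (2 * lacunaryExponent k)) :
    normA1 (kernel w) ≤ 20 * 2 ^ k := by
  have hN : (1 : ℝ) ≤ lacunaryExponent k := by exact_mod_cast lacunaryExponent_pos k
  set r := ‖(w : ℂ)‖ with hr
  have hinv : 1 / (2 * (lacunaryExponent k : ℝ)) ≤ 1 / 2 :=
    one_div_le_one_div_of_le two_pos (by linarith)
  have hinv0 : 0 < 1 / (2 * (lacunaryExponent k : ℝ)) := by positivity
  have hr2 : 1 / 4 ≤ r ^ 2 := by nlinarith
  have hlog : -Real.log (1 - r ^ 2) ≤ 5 * 2 ^ k := by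
    have h1 : 1 / (2 * (lacunaryExponent k : ℝ)) ≤ 1 - r ^ 2 := by nlinarith
    have h2 := Real.log_le_log hinv0 h1
    have h3 : Real.log (1 / (2 * (lacunaryExponent k : ℝ))) =
        -((2 * 2 ^ k + 3) * Real.log 2) := by
      have : (2 * (lacunaryExponent k : ℝ)) = 2 ^ (2 * 2 ^ k + 3) := by
        unfold lacunaryExponent; push_cast; ring
      rw [this, one_div, Real.log_inv, Real.log_pow]
      push_cast; rfl
    have h4 := Real.log_two_lt_d9
    have h5 : (1 : ℝ) ≤ 2 ^ k := one_le_pow₀ one_le_two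
    nlinarith
  rw [← norm_sq_mul_normA1_kernel, ← hr] at hlog
  nlinarith [normA1_kernel_pos w]

theorem not_dense_bloch : ¬ Dense {f : X | (f : HolDisc) ∈ Bloch} := by
  intro hdense
  -- With the bound `20·2ᵏ` on the kernel norm, `1/80` leaves an error `2ᵏ/4` on the circle, hence
  -- `2ᵏ/2` in the coefficient after division by `r ^ N ≥ 1/2`.
  obtain ⟨f, ⟨A, hA⟩, hfd⟩ := hdense.exists_dist_lt lacunaryX (show (0 : ℝ) < 1 / 80 by norm_num)
  rw [dist_eq_norm] at hfd
  have hbloch : ∀ z : 𝔻, (1 - ‖(z : ℂ)‖ ^ 2) * ‖f.1.derivAt z‖ ≤ A := fun z => hA ⟨z, rfl⟩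
  have hA0 : 0 ≤ A := le_trans (mul_nonneg (sub_nonneg.2 (Complex.UnitDisc.sq_norm_lt_one 0).le)
    (norm_nonneg _)) (hbloch 0)
  have hfX : ∀ z : 𝔻, ‖lacunary z - f.1 z‖ ≤ 1 / 80 * normA1 (kernel z) := fun z =>
    (mul_inv_le_iff₀ (normA1_kernel_pos z)).1 ((X.le_norm (lacunaryX - f) z).trans hfd.le)
  set φ := extendZero f.1 with hφ
  have hφd : DifferentiableOn ℂ φ (ball (0 : ℂ) 1) := f.1.differentiableOn
  -- The `Nₖ`-th coefficient of `φ` is at most `4A` in modulus and within `2ᵏ/2` of `2ᵏ`.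
  have key : ∀ k : ℕ, (2 : ℝ) ^ k ≤ 8 * A := by
    intro k
    set N := lacunaryExponent k with hN
    have hN1 : (1 : ℝ) ≤ N := by exact_mod_cast lacunaryExponent_pos k
    have hinv : 1 / (2 * (N : ℝ)) ≤ 1 / 2 := one_div_le_one_div_of_le two_pos (by linarith)
    have hinv0 : 0 < 1 / (2 * (N : ℝ)) := by positivity
    obtain ⟨r, hr⟩ : ∃ r : ℝ, r = 1 - 1 / (2 * N) := ⟨_, rfl⟩
    have h0 : 0 < r := by linarith
    have h1 : r < 1 := by linarith
    -- Bernoulli's inequality: this radius keeps `r ^ N` bounded below while `1 - r²` is still of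
    -- order `1/N`.
    have hrN : 1 / 2 ≤ r ^ N := by
      have h := one_add_mul_le_pow (a := -(1 / (2 * (N : ℝ)))) (by linarith) N
      have he : (N : ℝ) * -(1 / (2 * (N : ℝ))) = -(1 / 2) := by field_simp
      rw [he, ← sub_eq_add_neg, ← sub_eq_add_neg, ← hr] at h
      linarith
    have hrN0 : 0 < r ^ N := by positivity
    have hmem : ∀ z ∈ sphere (0 : ℂ) r, z ∈ ball (0 : ℂ) 1 := fun z hz => by
      rw [mem_ball_zero_iff, mem_sphere_zero_iff_norm.1 hz]; exact h1
    have hne : ∀ z ∈ sphere (0 : ℂ) r, z ^ (N + 1) ≠ 0 := fun z hz =>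
      pow_ne_zero _ (ne_of_mem_sphere hz h0.ne')
    have hlift : ∀ z ∈ sphere (0 : ℂ) r, ∃ w : 𝔻, (w : ℂ) = z ∧ ‖(w : ℂ)‖ = r := fun z hz =>
      ⟨Complex.UnitDisc.mk z (mem_ball_zero_iff.1 (hmem z hz)), rfl, mem_sphere_zero_iff_norm.1 hz⟩
    have hderiv : ‖∮ z in C(0, r), deriv φ z / z ^ N‖ ≤
        2 * Real.pi * r * (A * (2 * N) / r ^ N) := by
      refine circleIntegral.norm_integral_le_of_norm_le_const h0.le fun z hz => ?_
      obtain ⟨w, rfl, hw⟩ := hlift z hz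
      rw [norm_div, norm_pow, hw]
      have hb : (1 - r ^ 2) * ‖deriv φ w‖ ≤ A := hw ▸ hbloch w
      have hr2 : 1 / (2 * (N : ℝ)) ≤ 1 - r ^ 2 := by nlinarith
      have hc := (mul_le_mul_of_nonneg_right hr2 (norm_nonneg (deriv φ w))).trans hb
      rw [one_div_mul_eq_div, div_le_iff₀ (by positivity)] at hc
      gcongr
    -- Integration by parts gains a factor `N`, which cancels the `N` in the Bloch bound `|φ'| ≤
    -- 2NA`.
    have hf : ‖∮ z in C(0, r), φ z / z ^ (N + 1)‖ ≤ 2 * Real.pi * (4 * A) := by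
      rw [circleIntegral_deriv_div_pow hφd h0 h1, norm_mul, Complex.norm_natCast] at hderiv
      refine le_of_mul_le_mul_left (hderiv.trans ?_) (zero_lt_one.trans_le hN1)
      have hq : r * (A * (2 * N) / r ^ N) ≤ A * (2 * N) * 2 := by
        have hq1 : A * (2 * N) / r ^ N ≤ A * (2 * N) * 2 := by
          rw [div_le_iff₀ hrN0]
          have : 0 ≤ A * (2 * N) := by positivity
          nlinarith
        have : 0 ≤ A * (2 * N) / r ^ N := by positivity
        nlinarith
      calc 2 * Real.pi * r * (A * (2 * N) / r ^ N)
          = 2 * Real.pi * (r * (A * (2 * N) / r ^ N)) := by ring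
        _ ≤ 2 * Real.pi * (A * (2 * N) * 2) := by gcongr
        _ = N * (2 * Real.pi * (4 * A)) := by ring
    have hsub : ‖∮ z in C(0, r), (lacunary z / z ^ (N + 1) - φ z / z ^ (N + 1))‖ ≤
        2 * Real.pi * (2 ^ k / 2) := by
      have h : ‖∮ z in C(0, r), (lacunary z / z ^ (N + 1) - φ z / z ^ (N + 1))‖ ≤
          2 * Real.pi * r * (2 ^ k / 4 / r ^ (N + 1)) := by
        refine circleIntegral.norm_integral_le_of_norm_le_const h0.le fun z hz => ?_
        obtain ⟨w, rfl, hw⟩ := hlift z hz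
        rw [← sub_div, norm_div, norm_pow, hw, hφ, extendZero_coe]
        have h2 := hfX w
        have h3 := normA1_kernel_le_of_norm_eq (hw.trans hr)
        gcongr
        linarith
      refine h.trans ?_
      calc 2 * Real.pi * r * (2 ^ k / 4 / r ^ (N + 1))
          = 2 * Real.pi * (2 ^ k / 4 / r ^ N) := by rw [pow_succ]; field_simp
        _ ≤ 2 * Real.pi * (2 ^ k / 2) := by
          refine mul_le_mul_of_nonneg_left ?_ Real.two_pi_pos.le
          rw [div_le_iff₀ hrN0]
          have : (0 : ℝ) < 2 ^ k := by positivity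
          nlinarith
    have hint : ∀ g : ℂ → ℂ, DifferentiableOn ℂ g (ball (0 : ℂ) 1) →
        CircleIntegrable (fun z => g z / z ^ (N + 1)) 0 r := fun g hg =>
      ContinuousOn.circleIntegrable h0.le ((hg.continuousOn.mono hmem).div (by fun_prop) hne)
    rw [circleIntegral.integral_sub (hint _ differentiableOn_lacunary) (hint _ hφd),
      circleIntegral_lacunary_div_pow h0 h1] at hsub
    have htri := norm_le_norm_sub_add (2 ^ k * (2 * Real.pi * Complex.I) : ℂ)
      (∮ z in C(0, r), φ z / z ^ (N + 1))
    have hn : ‖(2 ^ k * (2 * Real.pi * Complex.I) : ℂ)‖ = 2 * Real.pi * 2 ^ k := by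
      simp [Real.pi_pos.le, mul_comm]
    rw [hn] at htri
    have hfin : 2 * Real.pi * 2 ^ k ≤ 2 * Real.pi * (2 ^ k / 2 + 4 * A) := by
      rw [mul_add]; linarith
    have := le_of_mul_le_mul_left hfin Real.two_pi_pos
    linarith
  obtain ⟨k, hk⟩ := pow_unbounded_of_one_lt (8 * A) (one_lt_two (α := ℝ))
  exact absurd (key k) (not_le.2 hk)

end BlochX

theorem theorem2p1 : ¬ Dense {f : BlochX.X | (f : BlochX.HolDisc) ∈ BlochX.Bloch} :=
  BlochX.not_dense_bloch
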